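/- Let $R$ be a commutative ring and $\mathcal A$ an associative unital (not necessarily commutative) $R$-algebra. An $R$-submodule $M\subseteq\mathcal A$ is a (two-sided) Mathieu subspace of $\mathcal A$ if, for every $a\in\mathcal A$ with $a^m\in M$ for all $m\ge 1$ and for all $b,c\in\mathcal A$, there is $N\ge 1$ such that $b a^m c\in M$ for all $m\ge N$. The algebra $\mathcal A$ is strongly simple if its only Mathieu subspaces are $0$ and $\mathcal A$. An integral domain $R$ with field of fractions $K_R$ is a Krull domain if there is a family of discrete valuations (with value group $\mathbb Z$) on $K_R$ such that $R$ is the intersection of their valuation rings and every nonzero $x\in K_R$ has nonzero value for only finitely many members of the family. Proposition 6.6. Let $R$ be a Krull domain or a Noetherian integral domain, and assume that $R$ is not a field. Then no $R$-algebra $\mathcal A$ containing $R$ (that is, for which the structure map $R\to\mathcal A$, $r\mapsto r\cdot 1_{\mathcal A}$, is injective) is strongly simple. Equivalently, every such $\mathcal A$ has a Mathieu subspace $M$ with $M\neq 0$ and $M\neq\mathcal A$. -/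

import Mathlib

/-- A (two-sided) Mathieu subspace of an associative unital `R`-algebra `A`: an `R`-submodule `M`
such that, whenever all powers `a ^ m`, `m ≥ 1`, lie in `M`, for all `b c : A` one has
`b * a ^ m * c ∈ M` for all sufficiently large `m` (depending on `a`, `b`, `c`). -/
def IsMathieuSubspace {R A : Type*} [CommRing R] [Ring A] [Algebra R A]
    (M : Submodule R A) : Prop :=
  ∀ a : A, (∀ m : ℕ, 1 ≤ m → a ^ m ∈ M) →
    ∀ b c : A, ∃ N : ℕ, ∀ m : ℕ, N ≤ m → b * a ^ m * c ∈ M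

/-- An `R`-algebra is strongly simple if it has no Mathieu subspace other than `0` and itself. -/
def IsStronglySimple (R A : Type*) [CommRing R] [Ring A] [Algebra R A] : Prop :=
  ∀ M : Submodule R A, IsMathieuSubspace M → M = ⊥ ∨ M = ⊤

/-- An integral domain `R` with field of fractions `K` is a Krull domain if there is a family of
discrete valuations on `K` (value group `ℤ`, normalized to be surjective) such that `R` is the
intersection of their valuation rings, and every nonzero `x : K` has nonzero (additive) value for
only finitely many of them. Valuations are written multiplicatively, so additive value `0` is `1`.
The family is taken as a set: by the finiteness condition a nontrivial valuation can only occur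
finitely often in a family, so dropping repetitions changes nothing. A field is a Krull domain
(empty family). -/
def IsKrullDomain (R : Type*) [CommRing R] [IsDomain R] : Prop :=
  ∃ S : Set (Valuation (FractionRing R) (WithZero (Multiplicative ℤ))),
    (∀ v ∈ S, Function.Surjective v) ∧
    (∀ x : FractionRing R,
      x ∈ Set.range (algebraMap R (FractionRing R)) ↔ ∀ v ∈ S, v x ≤ 1) ∧
    (∀ x : FractionRing R, x ≠ 0 → {v ∈ S | v x ≠ 1}.Finite)

/-! The idea is to compare `A` with the field of fractions `K` of `R`.

Two-sided ideals are Mathieu subspaces, so one may assume that `r A = A` for every nonzero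
`r : R`; otherwise some `r A` is nontrivial and proper. Then all nonzero elements of `R` are units
of `A`, and `A` is a `K`-algebra.

If `A ≠ K`, some line `K a` is a nontrivial Mathieu subspace
(`exists_isMathieuSubspace_or_surjective`). It is one whenever `a ^ 2 = 0` or `a ^ 2 ∉ K a`, and
otherwise every element of `A` is a scalar multiple of an idempotent. Since `K` is infinite, the
combinations `e + c (1 - e)` of an idempotent `e ≠ 0, 1` rule this out.

If `A = K`, one needs an `R`-submodule `M` of `K` into which `b a ^ m` eventually falls for all `a`
in `M` and `b` in `K`. The following serve: the maximal ideal of the valuation ring of one of the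
defining valuations when `R` is Krull, and the maximal ideal of the localization `R_p` at a
height-one prime `p` when `R` is Noetherian. The latter works because every nonzero ideal of the
one-dimensional local domain `R_p` contains a power of each element of its maximal ideal
(`exists_mul_pow_mem_span_of_height_le_one`). -/

/-! ### Constructions of Mathieu subspaces -/

theorem IsMathieuSubspace.map {R A B : Type*} [CommRing R] [Ring A] [Algebra R A] [Ring B]
    [Algebra R B] {M : Submodule R A} (hM : IsMathieuSubspace M) (f : A ≃ₐ[R] B) :
    IsMathieuSubspace (M.map f.toLinearMap) := by
  have key : ∀ x : B, x ∈ M.map f.toLinearMap ↔ f.symm x ∈ M := fun x => by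
    constructor
    · rintro ⟨y, hy, rfl⟩
      simpa using hy
    · exact fun h => ⟨f.symm x, h, by simp⟩
  intro a ha b c
  obtain ⟨N, hN⟩ := hM (f.symm a) (fun m hm => by
    rw [← map_pow]; exact (key _).1 (ha m hm)) (f.symm b) (f.symm c)
  refine ⟨N, fun m hm => (key _).2 ?_⟩
  simpa only [map_mul, map_pow] using hN m hm

/-- If multiplication by `r` is not surjective on `A`, its image is a Mathieu subspace, being a
two-sided ideal. -/
theorem isMathieuSubspace_range_lsmul {R A : Type*} [CommRing R] [Ring A] [Algebra R A] (r : R) :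
    IsMathieuSubspace (LinearMap.range (LinearMap.lsmul R A r)) := by
  intro a ha b c
  obtain ⟨x, hx⟩ := ha 1 le_rfl
  refine ⟨1, fun m hm => ⟨b * (x * a ^ (m - 1)) * c, ?_⟩⟩
  obtain ⟨k, rfl⟩ := Nat.exists_eq_add_of_le' hm
  have hx' : r • x = a := by simpa using hx
  simp [pow_succ', ← hx']

theorem isMathieuSubspace_span_singleton {K A : Type*} [Field K] [Ring A] [Algebra K A] {a : A}
    (ha : a ^ 2 = 0 ∨ a ^ 2 ∉ Submodule.span K {a}) :
    IsMathieuSubspace (Submodule.span K {a}) := by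
  intro x hx b c
  obtain ⟨k, hk⟩ := Submodule.mem_span_singleton.1 (hx 1 le_rfl)
  have hk' : x = k • a := by simpa using hk.symm
  have hx2 : x ^ 2 = 0 := by
    have h2 := hx 2 (by norm_num)
    rw [hk', smul_pow] at h2 ⊢
    rcases ha with ha | ha
    · rw [ha, smul_zero]
    · by_cases h0 : k = 0
      · simp [h0]
      · exact absurd ((Submodule.smul_mem_iff _ (pow_ne_zero 2 h0)).1 h2) ha
  refine ⟨2, fun m hm => ?_⟩
  simp [pow_eq_zero_of_le hm hx2]

/-! ### Algebras over an infinite field -/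

theorem exists_isMathieuSubspace_or_surjective (K A : Type*) [Field K] [Infinite K] [Ring A]
    [Nontrivial A] [Algebra K A] :
    (∃ M : Submodule K A, IsMathieuSubspace M ∧ M ≠ ⊥ ∧ M ≠ ⊤) ∨
      Function.Surjective (algebraMap K A) := by
  classical
  by_contra! hcon
  obtain ⟨hno, hsurj⟩ := hcon
  -- every nonzero element satisfies `a ^ 2 = μ a` with `μ ≠ 0`
  have key : ∀ a : A, a ≠ 0 → ∃ μ : K, μ ≠ 0 ∧ a * a = μ • a := by
    intro a ha
    by_contra! hμ
    have hM : a ^ 2 = 0 ∨ a ^ 2 ∉ Submodule.span K {a} := by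
      by_contra! h
      obtain ⟨μ, hμa⟩ := Submodule.mem_span_singleton.1 h.2
      refine hμ μ ?_ (by rw [← sq, hμa])
      rintro rfl
      exact h.1 (by rw [← hμa, zero_smul])
    have htop := hno _ (isMathieuSubspace_span_singleton hM) (by simpa using ha)
    obtain ⟨k, hk⟩ := Submodule.mem_span_singleton.1
      (htop ▸ Submodule.mem_top : (1 : A) ∈ Submodule.span K {a})
    have hk0 : k ≠ 0 := by
      rintro rfl
      simp at hk
    refine hμ k⁻¹ (inv_ne_zero hk0) ?_
    have ha' : a = k⁻¹ • (1 : A) := by rw [← hk, inv_smul_smul₀ hk0]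
    calc a * a = (k⁻¹ • (1 : A)) * a := by rw [← ha']
      _ = k⁻¹ • a := by rw [smul_mul_assoc, one_mul]
  obtain ⟨x, hx⟩ : ∃ x : A, ∀ k : K, algebraMap K A k ≠ x := by
    simpa [Function.Surjective] using hsurj
  have hx0 : x ≠ 0 := fun h => hx 0 (by simp [h])
  obtain ⟨μ, hμ0, hμ⟩ := key x hx0
  -- normalize `x` to an idempotent
  obtain ⟨e, he0, he1, hee⟩ : ∃ e : A, e ≠ 0 ∧ 1 - e ≠ 0 ∧ e * e = e := by
    refine ⟨μ⁻¹ • x, smul_ne_zero (inv_ne_zero hμ0) hx0, fun h => hx μ ?_, ?_⟩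
    · rw [Algebra.algebraMap_eq_smul_one, sub_eq_zero.1 h, smul_inv_smul₀ hμ0]
    · rw [smul_mul_smul_comm, hμ, smul_smul, mul_assoc, inv_mul_cancel₀ hμ0, mul_one]
  obtain ⟨c, hc⟩ := Infinite.exists_notMem_finset ({0, 1} : Finset K)
  simp only [Finset.mem_insert, Finset.mem_singleton, not_or] at hc
  have hef : e * (1 - e) = 0 := by rw [mul_sub, mul_one, hee, sub_self]
  have hff : (1 - e) * (1 - e) = 1 - e := by rw [sub_mul, one_mul, hef, sub_zero]
  set y : A := e + c • (1 - e) with hy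
  have hey : e * y = e := by rw [hy, mul_add, hee, mul_smul_comm, hef, smul_zero, add_zero]
  have hfy : (1 - e) * y = c • (1 - e) := by
    rw [hy, mul_add, mul_smul_comm, hff, sub_mul, one_mul, hee, sub_self, zero_add]
  obtain ⟨ν, -, hν⟩ := key y (fun h => he0 (by rw [← hey, h, mul_zero]))
  -- comparing the components along `e` and `1 - e` gives `ν = 1` and `ν = c`
  have h1 : (1 : K) • e = ν • e := by
    have := congrArg (e * ·) hν
    simpa only [← mul_assoc, hey, mul_smul_comm, one_smul] using this
  have h2 : (c * c) • (1 - e) = (ν * c) • (1 - e) := by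
    have := congrArg ((1 - e) * ·) hν
    simpa only [← mul_assoc, hfy, mul_smul_comm, smul_mul_assoc, smul_smul] using this
  have h1' := smul_left_injective K he0 h1
  have h2' := smul_left_injective K he1 h2
  rw [← h1'] at h2'
  exact hc.2 (mul_right_cancel₀ hc.1 h2')

/-! ### Submodules of the field of fractions -/

theorem exists_isMathieuSubspace_of_valuation {R K Γ : Type*} [CommRing R] [Field K] [Algebra R K]
    [LinearOrderedCommGroupWithZero Γ] [MulArchimedean Γ] (v : Valuation K Γ)
    (hR : ∀ r : R, v (algebraMap R K r) ≤ 1) (hv : ∃ x, v x ≠ 0 ∧ v x < 1) :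
    ∃ M : Submodule R K, IsMathieuSubspace M ∧ M ≠ ⊥ ∧ M ≠ ⊤ := by
  let M : Submodule R K :=
    { carrier := {x | v x < 1}
      add_mem' := fun hx hy => v.map_add_lt hx hy
      zero_mem' := by simp
      smul_mem' := fun r x hx => by
        change v (r • x) < 1
        rw [Algebra.smul_def, map_mul]
        exact (mul_le_of_le_one_left' (hR r)).trans_lt hx }
  refine ⟨M, fun a ha b c => ?_, ?_, ?_⟩
  · have ha1 : v a < 1 := by simpa [M] using ha 1 le_rfl
    by_cases hbc : v (b * c) = 0
    · refine ⟨0, fun m _ => ?_⟩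
      change v (b * a ^ m * c) < 1
      rw [mul_right_comm, map_mul, hbc, zero_mul]
      exact zero_lt_one
    · obtain ⟨N, hN⟩ := exists_pow_lt₀ ha1 (Units.mk0 _ hbc)⁻¹
      refine ⟨N, fun m hm => ?_⟩
      change v (b * a ^ m * c) < 1
      rw [mul_right_comm, map_mul, map_pow]
      have hlt : v a ^ m < (v (b * c))⁻¹ := by
        simpa using (pow_le_pow_right_of_le_one' ha1.le hm).trans_lt hN
      calc v (b * c) * v a ^ m < v (b * c) * (v (b * c))⁻¹ :=
            mul_lt_mul_of_pos_left hlt (zero_lt_iff.2 hbc)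
        _ = 1 := mul_inv_cancel₀ hbc
  · obtain ⟨x, hx0, hx1⟩ := hv
    intro h
    have hx : x ∈ M := hx1
    rw [h, Submodule.mem_bot] at hx
    exact hx0 (by simp [hx])
  · intro h
    have : (1 : K) ∈ M := h ▸ Submodule.mem_top
    exact absurd this (by simp [M])

theorem exists_isMathieuSubspace_of_isKrullDomain {R : Type*} [CommRing R] [IsDomain R]
    (hR : IsKrullDomain R) (hnf : ¬ IsField R) :
    ∃ M : Submodule R (FractionRing R), IsMathieuSubspace M ∧ M ≠ ⊥ ∧ M ≠ ⊤ := by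
  obtain ⟨S, hsurj, hint, -⟩ := hR
  -- an empty family would give `R = K`
  obtain ⟨v, hv⟩ : S.Nonempty := by
    by_contra! hS
    refine hnf ((IsFractionRing.surjective_iff_isField (K := FractionRing R)).1 fun x => ?_)
    exact (hint x).2 (by simp [hS])
  refine exists_isMathieuSubspace_of_valuation v (fun r => (hint _).1 ⟨r, rfl⟩ v hv) ?_
  obtain ⟨x, hx⟩ := hsurj v hv (WithZero.exp (-1))
  refine ⟨x, by simp [hx], ?_⟩
  rw [hx, ← WithZero.exp_zero, WithZero.exp_lt_exp]
  norm_num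

/-- The elements of a prime `p` of height at most one are nilpotent in `R_p / y R_p` for every
nonzero `y`. -/
theorem exists_mul_pow_mem_span_of_height_le_one {R : Type*} [CommRing R] [IsDomain R] {p : Ideal R}
    [p.IsPrime] (hp : p.height ≤ 1) {i y : R} (hi : i ∈ p) (hy : y ≠ 0) :
    ∃ n : ℕ, ∃ t ∉ p, t * i ^ n ∈ Ideal.span {y} := by
  by_contra! h
  have hdisj : Disjoint (Ideal.span {y} : Set R)
      (p.primeCompl ⊔ Submonoid.powers i : Submonoid R) := by
    rw [Set.disjoint_left]
    intro z hz hz'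
    obtain ⟨t, ht, _, ⟨n, rfl⟩, rfl⟩ := Submonoid.mem_sup.1 hz'
    exact h n t ht hz
  obtain ⟨q, hq, hyq, hqd⟩ := Ideal.exists_le_prime_disjoint _ _ hdisj
  rw [Set.disjoint_left] at hqd
  have hiq : i ∉ q := fun hiq => hqd hiq (Submonoid.mem_sup_right (Submonoid.mem_powers i))
  have hqp : q < p := by
    refine lt_of_le_of_ne (fun z hz => ?_) (fun h => hiq (h ▸ hi))
    by_contra hzp
    exact hqd hz (Submonoid.mem_sup_left hzp)
  have hq0 : q = ⊥ := by
    have := (Ideal.height_le_iff (n := 1)).1 (by exact_mod_cast hp) q hq hqp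
    rw [Nat.cast_one, Order.lt_one_iff] at this
    exact Ideal.height_eq_zero_iff_eq_bot.1 this
  exact hy (by simpa [hq0] using hyq (Ideal.mem_span_singleton_self y))

theorem exists_isMathieuSubspace_of_isNoetherianRing {R : Type*} (K : Type*) [CommRing R]
    [IsDomain R] [IsNoetherianRing R] [Field K] [Algebra R K] [IsFractionRing R K]
    (hnf : ¬ IsField R) :
    ∃ M : Submodule R K, IsMathieuSubspace M ∧ M ≠ ⊥ ∧ M ≠ ⊤ := by
  obtain ⟨r, hr0, hru⟩ := Ring.exists_not_isUnit_of_not_isField hnf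
  -- by the principal ideal theorem, a minimal prime over a nonzero nonunit `r` has height one
  obtain ⟨p, hpm⟩ := Ideal.nonempty_minimalPrimes
    (I := Ideal.span {r}) (by rwa [Ne, Ideal.span_singleton_eq_top])
  have hp : p.IsPrime := hpm.1.1
  have hrp : r ∈ p := hpm.1.2 (Ideal.mem_span_singleton_self r)
  have hheight : p.height ≤ 1 := Ideal.height_le_one_of_isPrincipal_of_mem_minimalPrimes _ p hpm
  -- the maximal ideal of `R_p`, viewed inside `K`
  let M : Submodule R K :=
    { carrier := {x | ∃ s ∉ p, ∃ i ∈ p, s • x = algebraMap R K i}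
      add_mem' := by
        rintro x y ⟨s, hs, i, hi, hx⟩ ⟨t, ht, j, hj, hy⟩
        refine ⟨s * t, hp.mul_notMem hs ht, t * i + s * j,
          p.add_mem (p.mul_mem_left _ hi) (p.mul_mem_left _ hj), ?_⟩
        rw [Algebra.smul_def] at hx hy ⊢
        simp only [map_mul, map_add, ← hx, ← hy]
        ring
      zero_mem' := ⟨1, hp.one_notMem, 0, p.zero_mem, by simp⟩
      smul_mem' := by
        rintro r x ⟨s, hs, i, hi, hx⟩
        refine ⟨s, hs, r * i, p.mul_mem_left _ hi, ?_⟩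
        rw [smul_comm, hx, Algebra.smul_def, map_mul] }
  refine ⟨M, fun a ha b c => ?_, ?_, ?_⟩
  · obtain ⟨s, hs, i, hi, hsa⟩ : ∃ s ∉ p, ∃ i ∈ p, s • a = algebraMap R K i := by
      simpa [M] using ha 1 le_rfl
    obtain ⟨x, y, hy, hbc⟩ := IsFractionRing.div_surjective (A := R) (b * c)
    have hy0 : y ≠ 0 := nonZeroDivisors.ne_zero hy
    have hy0' : algebraMap R K y ≠ 0 := by simpa using hy0
    obtain ⟨n, t, ht, hti⟩ := exists_mul_pow_mem_span_of_height_le_one hheight hi hy0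
    obtain ⟨z, hz⟩ := Ideal.mem_span_singleton'.1 hti
    refine ⟨n + 1, fun m hm => ?_⟩
    obtain ⟨k, rfl⟩ := Nat.exists_eq_add_of_le hm
    -- `b a ^ m c = (x / y) (i / s) ^ m` and `t i ^ n = z y`
    refine ⟨t * s ^ (n + 1 + k), hp.mul_notMem ht (fun h => hs (hp.mem_of_pow_mem _ h)),
      x * z * i ^ k * i, p.mul_mem_left _ hi, ?_⟩
    have hz' : algebraMap R K z * algebraMap R K y = algebraMap R K t * algebraMap R K i ^ n := by
      simpa using congrArg (algebraMap R K) hz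
    rw [Algebra.smul_def] at hsa ⊢
    simp only [map_mul, map_pow]
    calc algebraMap R K t * algebraMap R K s ^ (n + 1 + k) * (b * a ^ (n + 1 + k) * c)
        = algebraMap R K t * (algebraMap R K s * a) ^ (n + 1 + k) * (b * c) := by ring
      _ = algebraMap R K x / algebraMap R K y * (algebraMap R K t * algebraMap R K i ^ n) *
            (algebraMap R K i ^ k * algebraMap R K i) := by rw [hsa, ← hbc]; ring
      _ = _ := by rw [← hz']; field_simp
  · intro h
    have hr : algebraMap R K r ∈ M := ⟨1, hp.one_notMem, r, hrp, one_smul _ _⟩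
    rw [h, Submodule.mem_bot] at hr
    exact hr0 (by simpa using hr)
  · intro h
    obtain ⟨s, hs, i, hi, hsi⟩ : (1 : K) ∈ M := h ▸ Submodule.mem_top
    rw [← Algebra.algebraMap_eq_smul_one] at hsi
    exact hs (IsFractionRing.injective R K hsi ▸ hi)

/-! ### Passage to an algebra over the field of fractions -/

/-- If all nonzero elements of `R` become units in `A`, then `A` is an algebra over the field of
fractions. The localization map is lifted to the center of `A`, as `A` need not be commutative. -/
theorem exists_algebra_isScalarTower {R A : Type*} (K : Type*) [CommRing R] [IsDomain R] [Field K]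
    [Algebra R K] [IsFractionRing R K] [Ring A] [Algebra R A]
    (h : ∀ r : R, r ≠ 0 → ∃ u : A, r • u = 1) :
    ∃ _ : Algebra K A, IsScalarTower R K A := by
  have hu : ∀ r : nonZeroDivisors R, IsUnit (algebraMap R (Subalgebra.center R A) r) := by
    intro r
    obtain ⟨u, hu⟩ := h r (nonZeroDivisors.coe_ne_zero r)
    have hc : u ∈ Subalgebra.center R A := by
      rw [Subalgebra.mem_center_iff]
      intro b
      calc b * u = (r.1 • u) * (b * u) := by rw [hu, one_mul]
        _ = u * (b * (r.1 • u)) := by simp only [smul_mul_assoc, mul_smul_comm]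
        _ = u * b := by rw [hu, mul_one]
    refine IsUnit.of_mul_eq_one ⟨u, hc⟩ (Subtype.ext ?_)
    simpa [Algebra.smul_def] using hu
  let φ : K →+* Subalgebra.center R A := IsLocalization.lift hu
  let ψ : K →+* A := (Subalgebra.center R A).val.toRingHom.comp φ
  let _ : Algebra K A := ψ.toAlgebra' fun k x =>
    ((Subalgebra.mem_center_iff.1 (φ k).2) x).symm
  refine ⟨inferInstance, IsScalarTower.of_algebraMap_eq fun r => ?_⟩
  change _ = ((φ (algebraMap R K r) : Subalgebra.center R A) : A)
  rw [IsLocalization.lift_eq]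
  rfl

theorem proposition6p6 {R A : Type*} [CommRing R] [IsDomain R]
    (hR : IsKrullDomain R ∨ IsNoetherianRing R) (hnf : ¬ IsField R)
    [Ring A] [Algebra R A] (hRA : Function.Injective (algebraMap R A)) :
    ¬ IsStronglySimple R A ∧
      ∃ M : Submodule R A, IsMathieuSubspace M ∧ M ≠ ⊥ ∧ M ≠ ⊤ := by
  suffices h : ∃ M : Submodule R A, IsMathieuSubspace M ∧ M ≠ ⊥ ∧ M ≠ ⊤ by
    refine ⟨fun hs => ?_, h⟩
    obtain ⟨M, hM, hbot, htop⟩ := h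
    exact (hs M hM).elim hbot htop
  have : Nontrivial A := hRA.nontrivial
  by_cases hdiv : ∀ r : R, r ≠ 0 → ∃ u : A, r • u = 1
  · obtain ⟨_, _⟩ := exists_algebra_isScalarTower (FractionRing R) hdiv
    have : Infinite R := not_finite_iff_infinite.1 fun _ => hnf (Finite.isField_of_domain R)
    have : Infinite (FractionRing R) :=
      Infinite.of_injective _ (IsFractionRing.injective R (FractionRing R))
    rcases exists_isMathieuSubspace_or_surjective (FractionRing R) A with ⟨M, hM, hbot, htop⟩ | hs
    · refine ⟨M.restrictScalars R, hM, ?_, ?_⟩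
      · rwa [Ne, Submodule.restrictScalars_eq_bot_iff]
      · rwa [Ne, Submodule.restrictScalars_eq_top_iff]
    · obtain ⟨M, hM, hbot, htop⟩ :
          ∃ M : Submodule R (FractionRing R), IsMathieuSubspace M ∧ M ≠ ⊥ ∧ M ≠ ⊤ :=
        hR.elim (fun h => exists_isMathieuSubspace_of_isKrullDomain h hnf)
          (fun _ => exists_isMathieuSubspace_of_isNoetherianRing _ hnf)
      let f : FractionRing R ≃ₐ[R] A := AlgEquiv.ofBijective
        (IsScalarTower.toAlgHom R (FractionRing R) A) ⟨(algebraMap (FractionRing R) A).injective, hs⟩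
      refine ⟨M.map f.toLinearMap, hM.map f, ?_, ?_⟩
      · intro h
        exact hbot (Submodule.map_injective_of_injective f.injective
          (h.trans (Submodule.map_bot _).symm))
      · intro h
        refine htop (Submodule.map_injective_of_injective f.injective (h.trans ?_))
        exact (LinearMap.range_eq_top.2 f.surjective).symm.trans (Submodule.map_top _).symm
  · push Not at hdiv
    obtain ⟨r, hr, hu⟩ := hdiv
    refine ⟨_, isMathieuSubspace_range_lsmul r, fun h => hr (hRA ?_), fun h => ?_⟩
    · have hr1 : LinearMap.lsmul R A r 1 ∈ LinearMap.range (LinearMap.lsmul R A r) := ⟨1, rfl⟩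
      rw [h, Submodule.mem_bot] at hr1
      simpa [Algebra.algebraMap_eq_smul_one] using hr1
    · obtain ⟨u, h1⟩ := LinearMap.range_eq_top.1 h 1
      exact hu u (by simpa using h1)
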